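/- **Theorem 4.2.** Let $G$ be a locally compact, $\sigma$-compact topological group (for instance a Lie group with countably many components, or a finitely generated discrete group), and let $M$ be a *homogeneous metric measure space* of $G$. This means that $(M,d)$ is a connected, locally compact metric space with a Borel measure $\mu$ that is finite on compact sets; $G$ acts continuously and transitively on $M$ with compact isotropy subgroups; $d$ and $\mu$ are $G$-invariant; $d$ is compatible with the lengths of curves, i.e. there is a constant $L$ such that any two points $x,y\in M$ are joined by a curve of length at most $L\,d(x,y)$ (as for Riemannian and Carnot–Carathéodory distances); and the isoperimetric profile $$I(t)=\inf\{\mu^+(A): A\subset M\text{ Borel},\ \mu(A)=t\},\qquad \mu^+(A)=\liminf_{h\to0^+}\frac{\mu(\{x: d(x,A)<h\})-\mu(A)}{h},$$ is finite, concave and continuous on $[0,\mu(M))$ with $I(0)=0$, symmetric around $\mu(M)/2$ if $\mu(M)<\infty$, and increasing (in the weak sense) if $\mu(M)=\infty$. Let $w:M\to[0,\infty)$ be a $\mu$-measurable function such that $$\mu(\{w\le r\})\le\mu(B(r))\qquad\text{for all } r>0,$$ where $B(r)$ is a closed ball of radius $r$ in $M$ (the measure does not depend on the centre; the same hypothesis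 with open balls is stronger, so that the theorem covers it). Then $w>0$ $\mu$-a.e., and there is a constant $C>0$ such that $$\frac{\min\{\mu(\{w\le r\}),\mu(M)/2\}}{I\big(\min\{\mu(\{w\le r\}),\mu(M)/2\}\big)}\le C\,r\qquad\text{for all } r>0,$$ where the quotient is read as $0$ if $\mu(\{w\le r\})=0$. In particular, if $w$ is moreover locally integrable, then $w$ is an isoperimetric weight, i.e. a locally integrable function $w:M\to[0,\infty)$ that is positive a.e. and satisfies the last inequality for some $C>0$. -/

import Mathlib

open MeasureTheory Set Filter Topology
open scoped ENNReal

noncomputable section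

/-- The perimeter (lower outer Minkowski content)
`μ⁺(A) = liminf_{h → 0⁺} (μ(A_h) - μ(A)) / h`, where `A_h = {x | d(x, A) < h}`. -/
def minkowskiContent {M : Type*} [MetricSpace M] [MeasurableSpace M]
    (μ : Measure M) (A : Set M) : ℝ≥0∞ :=
  liminf (fun h : ℝ => (μ (Metric.thickening h A) - μ A) / ENNReal.ofReal h) (𝓝[>] 0)

/-- The isoperimetric profile `I(t) = inf {μ⁺(A) | A Borel, μ(A) = t}`, as an extended
nonnegative number (an infimum over no set at all is `∞`). -/
def isoProfile {M : Type*} [MetricSpace M] [MeasurableSpace M]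
    (μ : Measure M) (t : ℝ≥0∞) : ℝ≥0∞ :=
  ⨅ (A : Set M) (_ : MeasurableSet A) (_ : μ A = t), minkowskiContent μ A

/-- The domain `[0, μ(M))` of the isoperimetric profile, as a set of real numbers. -/
def profileDomain {M : Type*} [MeasurableSpace M] (μ : Measure M) : Set ℝ :=
  {t : ℝ | 0 ≤ t ∧ ENNReal.ofReal t < μ univ}

/-- The standing assumptions on the isoperimetric profile `I : [0, μ(M)) → [0, ∞)`: it is
finite, concave, continuous and zero at zero; it is symmetric around `μ(M)/2` if
`μ(M) < ∞`, and increasing (in the weak sense) if `μ(M) = ∞`. -/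
structure HasConcaveProfile {M : Type*} [MetricSpace M] [MeasurableSpace M]
    (μ : Measure M) : Prop where
  finite : ∀ t ∈ profileDomain μ, isoProfile μ (ENNReal.ofReal t) ≠ ∞
  concave : ConcaveOn ℝ (profileDomain μ) fun t => (isoProfile μ (ENNReal.ofReal t)).toReal
  continuous : ContinuousOn (fun t => (isoProfile μ (ENNReal.ofReal t)).toReal)
    (profileDomain μ)
  zero : isoProfile μ 0 = 0
  symmetric : μ univ ≠ ∞ → ∀ t ∈ profileDomain μ, 0 < t →
    isoProfile μ (μ univ - ENNReal.ofReal t) = isoProfile μ (ENNReal.ofReal t)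
  increasing : μ univ = ∞ → MonotoneOn (isoProfile μ) (Iio ∞)

/-- Compatibility of the distance with the lengths of curves: for some constant `L`, any two
points `x`, `y` are joined by a curve of length at most `L d(x, y)`. Every length distance
(Riemannian, Carnot-Carathéodory, ...) has this property. -/
def IsLengthCompatible (M : Type*) [MetricSpace M] : Prop :=
  ∃ L : NNReal, ∀ x y : M, ∃ γ : Path x y,
    eVariationOn (γ : unitInterval → M) univ ≤ (L : ℝ≥0∞) * edist x y

/-- `M`, with its metric and the Borel measure `μ`, is a homogeneous metric measure space of
the group `G`: it is connected and locally compact, `G` acts continuously and transitively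
with compact isotropy subgroups, the distance and the measure are invariant, the distance is
compatible with the lengths of curves, `μ` is finite on compact sets, and the isoperimetric
profile satisfies the standing assumptions. -/
structure IsHomogeneousMMS (G : Type*) {M : Type*} [Group G] [TopologicalSpace G]
    [MetricSpace M] [MeasurableSpace M] [MulAction G M] (μ : Measure M) : Prop where
  connected : ConnectedSpace M
  locallyCompact : LocallyCompactSpace M
  continuous_action : ContinuousSMul G M
  transitive : MulAction.IsPretransitive G M
  isotropy_compact : ∀ x : M, IsCompact (MulAction.stabilizer G x : Set G)
  invariant_dist : ∀ (g : G) (x y : M), dist (g • x) (g • y) = dist x y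
  invariant_measure : ∀ (g : G) (A : Set M), MeasurableSet A → μ ((g • ·) ⁻¹' A) = μ A
  length_compatible : IsLengthCompatible M
  finite_on_compacts : ∀ K : Set M, IsCompact K → μ K < ∞
  profile : HasConcaveProfile μ

/-- The growth bound in the definition of isoperimetric weights: there is `C > 0` with
`min {μ{w ≤ r}, μ(M)/2} / I(min {μ{w ≤ r}, μ(M)/2}) ≤ C r` for all `r > 0`.
The quotient is taken in `[0, ∞]`, where `0 / 0 = 0` and `t / 0 = ∞` for `t > 0`. -/
def HasIsoperimetricGrowth {M : Type*} [MetricSpace M] [MeasurableSpace M]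
    (μ : Measure M) (w : M → ℝ) : Prop :=
  ∃ C : ℝ, 0 < C ∧ ∀ r : ℝ, 0 < r →
    min (μ {x | w x ≤ r}) (μ univ / 2) / isoProfile μ (min (μ {x | w x ≤ r}) (μ univ / 2))
      ≤ ENNReal.ofReal (C * r)

/-- Isoperimetric weights: locally integrable functions `w : M → [0, ∞)`, positive almost
everywhere, that satisfy the growth bound. -/
structure IsIsoperimetricWeight {M : Type*} [MetricSpace M] [MeasurableSpace M]
    (μ : Measure M) (w : M → ℝ) : Prop where
  nonneg : ∀ x, 0 ≤ w x
  locallyIntegrable : LocallyIntegrable w μ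
  pos : ∀ᵐ x ∂μ, 0 < w x
  growth : HasIsoperimetricGrowth μ w

end

/-! By uniqueness of invariant measures, the orbit map `g ↦ g • x` pushes a Haar measure `ν` of `G`
to `δ x` times `μ` (`exists_orbit_measure`); the density `δ` reflects the modular function.

Suppose first that `δ` is constant and that `A` fills at most half of `B(o, r)`. Averaging over `z`
in the ball bounds `δ o * μ A` by twice the supremum of `ν {g | g • o ∈ A ∧ g • z ∉ A}`
(`orbit_measure_le_of_exit_le`). A curve from `o` to `z` is cut into about `L r / h` steps shorter
than `h`; a step leaves `A` only into `A_h \ A`, where `A_h` is the thickening. Letting `h → 0`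
gives `μ(A) ≤ C r μ⁺(A)`.

If `δ b < δ a`, then along a chain from `a` to `b` each step lowers `δ` by a factor of at most
`μ(A_h) / μ(A)`. Taking logarithms yields `μ(A) ≤ c μ⁺(A)` (`exists_linear_isoperimetric_of_ne`),
which suffices for `r ≥ 1`. For `r ≤ 1` the first argument still works, since `δ` is bounded near
`o`.

For the growth bound, let `m` be the minimum in question, so `m ≤ μ(B(r))`. The inequality applies
to sets of measure `m / 2`, and `I(m / 2) ≤ I(m)` (`HasConcaveProfile.isoProfile_half_le`).
Positivity of `w` holds because `μ{w = 0} ≤ μ(B(r)) → μ{o} = 0`. -/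

/-! ### Chains along curves, and properness. -/

/-- Along a curve of variation at most `N η`, one can go from any point to the end in `N + 1` steps
of length at most `η`. -/
lemma exists_chain_of_variation_le {M : Type*} [MetricSpace M] {x y : M} (γ : Path x y) {η : ℝ}
    (hη : 0 < η) (N : ℕ) : ∀ t : unitInterval,
    eVariationOn (γ : unitInterval → M) (Icc t 1) ≤ ENNReal.ofReal (N * η) →
    ∃ f : ℕ → M, f 0 = γ t ∧ f (N + 1) = y ∧ (∀ i < N + 1, dist (f i) (f (i + 1)) ≤ η) ∧
      ∀ i, f i ∈ range γ := by
  have short : ∀ (N : ℕ) (t : unitInterval), dist (γ t) y ≤ η →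
      ∃ f : ℕ → M, f 0 = γ t ∧ f (N + 1) = y ∧ (∀ i < N + 1, dist (f i) (f (i + 1)) ≤ η) ∧
        ∀ i, f i ∈ range γ := by
    intro N t ht
    refine ⟨fun i => if i = 0 then γ t else y, by simp, by simp, ?_, ?_⟩
    · intro i _
      by_cases h : i = 0 <;> simp [h, ht, hη.le]
    · intro i
      by_cases h : i = 0
      · simp [h]
      · simp only [if_neg h]
        exact ⟨1, γ.target⟩
  have far : ∀ s t : unitInterval, s ≤ t →
      edist (γ s) (γ t) ≤ eVariationOn (γ : unitInterval → M) (Icc s t) := fun s t hst =>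
    eVariationOn.edist_le _ (left_mem_Icc.2 hst) (right_mem_Icc.2 hst)
  induction N with
  | zero =>
    intro t ht
    refine short 0 t ?_
    have := (far t 1 t.2.2).trans ht
    simp only [Nat.cast_zero, zero_mul, ENNReal.ofReal_zero, nonpos_iff_eq_zero, edist_eq_zero,
      γ.target] at this
    simp [this, hη.le]
  | succ N ih =>
    intro t ht
    by_cases hd : dist (γ t) y ≤ η
    · exact short (N + 1) t hd
    push Not at hd
    have hcont : ContinuousOn (fun s => dist (γ t) (γ s)) (Icc t 1) := by fun_prop
    -- The curve reaches distance exactly `η` at `s`, which uses up at least `η` of the variation.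
    obtain ⟨s, hs, hse⟩ := intermediate_value_Icc (a := t) (b := 1) t.2.2 hcont
      (show η ∈ Icc _ _ by simp [hη.le, hd.le])
    have hadd := eVariationOn.Icc_add_Icc (γ : unitInterval → M) (s := univ) hs.1 hs.2 (mem_univ s)
    simp only [univ_inter] at hadd
    have h1 : ENNReal.ofReal η ≤ eVariationOn (γ : unitInterval → M) (Icc t s) := by
      refine le_trans (le_of_eq ?_) (far t s hs.1)
      rw [edist_dist]; exact congrArg _ hse.symm
    have h2 : eVariationOn (γ : unitInterval → M) (Icc s 1) ≤ ENNReal.ofReal (N * η) := by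
      have : ENNReal.ofReal η + eVariationOn (γ : unitInterval → M) (Icc s 1)
          ≤ ENNReal.ofReal η + ENNReal.ofReal (N * η) := by
        rw [← ENNReal.ofReal_add hη.le (by positivity)]
        calc _ ≤ _ := by gcongr
          _ = _ := hadd
          _ ≤ _ := ht
          _ = _ := by push_cast; ring_nf
      exact (ENNReal.add_le_add_iff_left ENNReal.ofReal_ne_top).1 this
    obtain ⟨f, f0, fN, fd, fr⟩ := ih s h2
    refine ⟨fun i => Nat.casesOn i (γ t) f, rfl, fN, ?_, ?_⟩
    · rintro (_ | i) hi
      · simpa [f0] using hse.le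
      · exact fd i (by omega)
    · rintro (_ | i)
      · exact ⟨t, rfl⟩
      · exact fr i

/-- The ends of a curve of length at most `ℓ` are joined by a chain of about `ℓ / h` steps of length
less than `h` that stays within `ℓ` of its origin. -/
lemma exists_chain {M : Type*} [MetricSpace M] {x y : M} (γ : Path x y) {ℓ h : ℝ} (hh : 0 < h)
    (hl : h ≤ ℓ) (hγ : eVariationOn (γ : unitInterval → M) univ ≤ ENNReal.ofReal ℓ) :
    ∃ n : ℕ, n * h ≤ 4 * ℓ ∧ ∃ f : ℕ → M, f 0 = x ∧ f n = y ∧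
      (∀ i < n, dist (f i) (f (i + 1)) < h) ∧ ∀ i, dist (f i) x ≤ ℓ := by
  have hℓ : 0 < ℓ := hh.trans_le hl
  -- Steps of length at most `h / 2` give the strict bound by `h`; then `(N + 1) h < 2 ℓ + 2 h ≤ 4
  -- ℓ` because `h ≤ ℓ`.
  set N := ⌈2 * ℓ / h⌉₊
  have hN1 : 2 * ℓ / h ≤ N := Nat.le_ceil _
  have hN2 : (N : ℝ) < 2 * ℓ / h + 1 := Nat.ceil_lt_add_one (by positivity)
  have hN3 : ℓ ≤ N * (h / 2) := by
    rw [div_le_iff₀ hh] at hN1; linarith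
  obtain ⟨f, f0, fN, fd, fr⟩ := exists_chain_of_variation_le γ (half_pos hh) N 0 (by
    refine (eVariationOn.mono _ (subset_univ _)).trans (hγ.trans ?_)
    exact ENNReal.ofReal_le_ofReal hN3)
  refine ⟨N + 1, ?_, f, by simp [f0], fN, fun i hi => (fd i hi).trans_lt (by linarith),
    fun i => ?_⟩
  · have : (N : ℝ) * h < 2 * ℓ + h := by
      have := mul_lt_mul_of_pos_right hN2 hh
      have e : (2 * ℓ / h + 1) * h = 2 * ℓ + h := by field_simp
      linarith
    push_cast; linarith
  · obtain ⟨t, ht⟩ := fr i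
    have h1 : edist (γ t) (γ 0) ≤ ENNReal.ofReal ℓ :=
      (eVariationOn.edist_le _ (mem_univ _) (mem_univ _)).trans hγ
    rw [edist_dist, γ.source, ht] at h1
    exact (ENNReal.ofReal_le_ofReal_iff hℓ.le).1 h1

/-- A metric space compatible with the lengths of curves whose balls of a fixed radius are compact
is proper. -/
lemma IsLengthCompatible.properSpace {M : Type*} [MetricSpace M] (hL : IsLengthCompatible M)
    {ε : ℝ} (hε : 0 < ε) (hc : ∀ x : M, IsCompact (Metric.closedBall x ε)) (o : M) :
    ProperSpace M := by
  obtain ⟨L, hL⟩ := hL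
  have step : ∀ K : Set M, IsCompact K → ∃ K' : Set M, IsCompact K' ∧
      ∀ x ∈ K, ∀ y, dist x y < ε / 2 → y ∈ K' := by
    intro K hK
    obtain ⟨t, -, ht, hKt⟩ := hK.finite_cover_balls (half_pos hε)
    refine ⟨⋃ x ∈ t, Metric.closedBall x ε, ht.isCompact_biUnion fun x _ => hc x, ?_⟩
    intro x hx y hxy
    obtain ⟨z, hz, hxz⟩ := mem_iUnion₂.1 (hKt hx)
    refine mem_iUnion₂.2 ⟨z, hz, ?_⟩
    rw [Metric.mem_ball] at hxz
    rw [Metric.mem_closedBall]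
    have := dist_triangle y x z
    rw [dist_comm y x] at this
    linarith
  choose! S hS1 hS2 using step
  -- `K n` is compact and contains all points reached from `o` in `n` steps shorter than `ε / 2`.
  let K : ℕ → Set M := fun n => Nat.rec {o} (fun _ K => S K) n
  have hK : ∀ n, IsCompact (K n) := by
    intro n
    induction n with
    | zero => exact isCompact_singleton
    | succ n ih => exact hS1 _ ih
  refine ProperSpace.of_seq_closedBall (x := o) (r := fun R : ℝ => R) (l := atTop) tendsto_id ?_
  refine Eventually.of_forall fun R => ?_
  set ℓ := max (L * R) (ε / 2)
  have hℓ : ε / 2 ≤ ℓ := le_max_right _ _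
  have hsub : Metric.closedBall o R ⊆ ⋃ n ∈ Iic ⌊4 * ℓ / (ε / 2)⌋₊, K n := by
    intro y hy
    obtain ⟨γ, hγ⟩ := hL o y
    obtain ⟨n, hn, f, f0, fn, fd, -⟩ := exists_chain γ (half_pos hε) hℓ (by
      refine hγ.trans ?_
      rw [edist_dist, ← ENNReal.ofReal_coe_nnreal, ← ENNReal.ofReal_mul L.coe_nonneg]
      refine ENNReal.ofReal_le_ofReal ((mul_le_mul_of_nonneg_left ?_ L.2).trans (le_max_left _ _))
      rw [dist_comm]; exact hy)
    have hmem : ∀ i ≤ n, f i ∈ K i := by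
      intro i
      induction i with
      | zero => intro _; simp [K, f0]
      | succ i ih => intro hi; exact hS2 _ (hK i) _ (ih (by omega)) _ (fd i (by omega))
    refine mem_iUnion₂.2 ⟨n, ?_, fn ▸ hmem n le_rfl⟩
    exact Nat.le_floor ((le_div_iff₀ (half_pos hε)).2 hn)
  exact ((finite_Iic _).isCompact_biUnion fun n _ => hK n).of_isClosed_subset
    Metric.isClosed_closedBall hsub

/-! ### Haar measure under the orbit maps. -/

/-- A nonzero invariant measure charges every ball. -/
lemma measure_closedBall_pos_of_smulInvariant (G : Type*) {M : Type*} [Group G] [MetricSpace M]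
    [SecondCountableTopology M] [MeasurableSpace M] [MulAction G M]
    [IsIsometricSMul G M] [MulAction.IsPretransitive G M] (μ : Measure M)
    [SMulInvariantMeasure G M μ] [BorelSpace M] (hμ : μ ≠ 0) (o : M) {r : ℝ} (hr : 0 < r) :
    0 < μ (Metric.closedBall o r) := by
  rw [pos_iff_ne_zero]
  intro h0
  apply hμ
  have hball : ∀ x : M, μ (Metric.ball x r) = 0 := by
    intro x
    obtain ⟨g, rfl⟩ := MulAction.exists_smul_eq G x o
    rw [← nonpos_iff_eq_zero, ← h0, ← SMulInvariantMeasure.measure_preimage_smul (μ := μ) g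
      (Metric.isClosed_closedBall (x := g • x) (ε := r)).measurableSet]
    refine measure_mono fun y hy => ?_
    simpa [dist_smul] using (Metric.mem_ball.1 hy).le
  rw [← Measure.measure_univ_eq_zero]
  exact measure_null_of_locally_null _ fun x _ =>
    ⟨Metric.ball x r, mem_nhdsWithin_of_mem_nhds (Metric.ball_mem_nhds x hr), hball x⟩

/-- Uniqueness of invariant measures: the images of Haar measure under the orbit maps are the
multiples of the invariant measure. -/
lemma exists_orbit_measure_of_secondCountable {G M : Type*} [Group G] [TopologicalSpace G]
    [IsTopologicalGroup G] [SecondCountableTopology G] [LocallyCompactSpace G]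
    [MetricSpace M] [ProperSpace M] [MeasurableSpace M] [BorelSpace M] [MulAction G M]
    [IsIsometricSMul G M] [MulAction.IsPretransitive G M] [ContinuousSMul G M] (μ : Measure M)
    [SMulInvariantMeasure G M μ] [IsFiniteMeasureOnCompacts μ] (hμ : μ ≠ 0) (o : M)
    (hK : IsCompact {g : G | dist (g • o) o ≤ 1}) :
    ∃ (_ : MeasurableSpace G) (ν : Measure G) (δ : M → ℝ≥0∞), SFinite ν ∧
      Measurable (fun p : G × M => p.1 • p.2) ∧ (∀ x, δ x ≠ 0 ∧ δ x ≠ ∞) ∧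
      ∀ x A, MeasurableSet A → ν {g | g • x ∈ A} = δ x * μ A := by
  have : SecondCountableTopology M := secondCountable_of_proper
  borelize G
  have hmeas : Measurable (fun p : G × M => p.1 • p.2) := continuous_smul.measurable
  let ν : Measure G := Measure.haar
  have hmeas' : ∀ x : M, Measurable (fun g : G => g • x) := fun x =>
    hmeas.comp (measurable_id.prodMk measurable_const)
  -- A right translate of Haar measure is left invariant, hence a multiple of it: `D` is the modular
  -- factor.
  have hmod : ∀ g : G, ∃ D : NNReal, D ≠ 0 ∧ ν.map (· * g) = D • ν := fun g =>
    ⟨_, (Measure.haarScalarFactor_pos_of_isHaarMeasure (ν.map (· * g)) ν).ne',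
      Measure.isMulLeftInvariant_eq_smul (ν.map (· * g)) ν⟩
  choose D hD0 hD using hmod
  have horb : ∀ (g : G) (A : Set M), MeasurableSet A →
      ν {h | h • g • o ∈ A} = D g * ν {h | h • o ∈ A} := by
    intro g A hA
    have := congrArg (fun m : Measure G => m {h | h • o ∈ A}) (hD g)
    simp only [Measure.smul_apply] at this
    rw [Measure.map_apply (measurable_mul_const g) (show MeasurableSet {h : G | h • o ∈ A} from
      hmeas' o hA)] at this
    simp only [preimage_ofPred_eq, mul_smul] at this
    rw [this]; rfl
  choose s hs using fun x : M => MulAction.exists_smul_eq G o x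
  set B := Metric.closedBall o 1
  have hB : MeasurableSet B := Metric.isClosed_closedBall.measurableSet
  have hBpos : 0 < μ B := measure_closedBall_pos_of_smulInvariant G μ hμ o one_pos
  have hBfin : μ B ≠ ∞ := (isCompact_closedBall o 1).measure_lt_top.ne
  set c := ν {g | g • o ∈ B}
  have hcfin : c ≠ ∞ := hK.measure_lt_top.ne
  have hcpos : c ≠ 0 := by
    have hopen : IsOpen {g : G | g • o ∈ Metric.ball o 1} :=
      Metric.isOpen_ball.preimage (continuous_id.smul continuous_const)
    refine ((hopen.measure_pos ν ⟨1, by simp⟩).trans_le (measure_mono fun g hg => ?_)).ne'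
    exact Metric.ball_subset_closedBall hg
  -- Fubini for the function `(g, z) ↦ 1_A (g z) 1_B (z)`
  have fubini : ∀ A, MeasurableSet A →
      ∫⁻ z in B, ν {g | g • z ∈ A} ∂μ = c * μ A := by
    intro A hA
    have h1 : ∫⁻ z in B, ν {g | g • z ∈ A} ∂μ
        = ∫⁻ z in B, ∫⁻ g, A.indicator 1 (g • z) ∂ν ∂μ := by
      refine lintegral_congr fun z => ?_
      exact (lintegral_indicator_one (hmeas' z hA)).symm
    have h2 : ∫⁻ z in B, ∫⁻ g, A.indicator 1 (g • z) ∂ν ∂μ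
        = ∫⁻ g, ∫⁻ z in B, A.indicator (1 : M → ℝ≥0∞) (g • z) ∂μ ∂ν := by
      refine lintegral_lintegral_swap ?_
      exact ((measurable_one.indicator hA).comp (hmeas.comp measurable_swap)).aemeasurable
    have h3 : ∀ g : G, ∫⁻ z in B, A.indicator (1 : M → ℝ≥0∞) (g • z) ∂μ
        = ∫⁻ x in A, B.indicator 1 (g⁻¹ • x) ∂μ := by
      intro g
      have hm : Measurable (fun z : M => g • z) := (continuous_const_smul g).measurable
      have e1 : ∫⁻ z in B, A.indicator (1 : M → ℝ≥0∞) (g • z) ∂μ = μ ((g • ·) ⁻¹' A ∩ B) := by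
        have : (fun z => A.indicator (1 : M → ℝ≥0∞) (g • z)) = ((g • ·) ⁻¹' A).indicator 1 := rfl
        rw [this, lintegral_indicator_one (hm hA), Measure.restrict_apply (hm hA)]
      have hm' : Measurable (fun z : M => g⁻¹ • z) := (continuous_const_smul g⁻¹).measurable
      have e2 : ∫⁻ x in A, B.indicator (1 : M → ℝ≥0∞) (g⁻¹ • x) ∂μ
          = μ ((g⁻¹ • ·) ⁻¹' B ∩ A) := by
        have : (fun z => B.indicator (1 : M → ℝ≥0∞) (g⁻¹ • z)) = ((g⁻¹ • ·) ⁻¹' B).indicator 1 :=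
          rfl
        rw [this, lintegral_indicator_one (hm' hB), Measure.restrict_apply (hm' hB)]
      rw [e1, e2, ← SMulInvariantMeasure.measure_preimage_smul (μ := μ) g ((hm' hB).inter hA)]
      congr 1
      ext z
      simp [and_comm]
    have h4 : ∫⁻ g, ∫⁻ x in A, B.indicator (1 : M → ℝ≥0∞) (g⁻¹ • x) ∂μ ∂ν
        = ∫⁻ x in A, ∫⁻ g, B.indicator (1 : M → ℝ≥0∞) (g⁻¹ • x) ∂ν ∂μ := by
      refine lintegral_lintegral_swap ?_
      have hi : Measurable fun p : G × M => (p.1⁻¹, p.2) :=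
        measurable_fst.inv.prodMk measurable_snd
      have hf : Measurable (B.indicator (1 : M → ℝ≥0∞)) := measurable_one.indicator hB
      exact (hf.comp (hmeas.comp hi)).aemeasurable
    -- Left translation by `s x` moves `x` back to `o`, and `d(g⁻¹ o, o) = d(o, g o)`. Thus the
    -- inverse disappears without inverting Haar measure.
    have h5 : ∀ x : M, ∫⁻ g, B.indicator (1 : M → ℝ≥0∞) (g⁻¹ • x) ∂ν = c := by
      intro x
      have : (fun g : G => B.indicator (1 : M → ℝ≥0∞) (g⁻¹ • x))
          = {g : G | g⁻¹ • x ∈ B}.indicator 1 := rfl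
      have hm : MeasurableSet {g : G | g⁻¹ • x ∈ B} :=
        (hmeas' x).comp measurable_inv hB
      rw [this, lintegral_indicator_one hm, ← measure_preimage_mul ν (s x)]
      congr 1
      ext g
      simp only [preimage_ofPred_eq, mem_ofPred_eq, mul_inv_rev, mul_smul, B, Metric.mem_closedBall]
      have hx : (s x)⁻¹ • x = o := by rw [inv_smul_eq_iff, hs x]
      rw [hx, ← dist_smul g, smul_inv_smul, dist_comm]
    rw [h1, h2, lintegral_congr h3, h4, lintegral_congr h5, setLIntegral_const]
  have hDs : ∀ x A, MeasurableSet A → ν {g | g • x ∈ A} = D (s x) * ν {g | g • o ∈ A} := by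
    intro x A hA
    simpa only [hs x] using horb (s x) A hA
  -- The section `s` comes from choice, but `D (s z)` is the quotient of a measurable function of
  -- `z` by a constant.
  have hDm : Measurable (fun z => (D (s z) : ℝ≥0∞)) := by
    have h1 : Measurable fun z : M => ν {g | g • z ∈ B} :=
      measurable_measure_prodMk_right (hmeas hB)
    have h2 : (fun z => (D (s z) : ℝ≥0∞)) = fun z => ν {g | g • z ∈ B} / c := by
      funext z
      rw [hDs z B hB, ENNReal.mul_div_cancel_right hcpos hcfin]
    rw [h2]
    exact h1.div_const c
  have hνo : ∀ A, MeasurableSet A → (∫⁻ z in B, D (s z) ∂μ) * ν {g | g • o ∈ A} = c * μ A := by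
    intro A hA
    rw [← fubini A hA, ← lintegral_mul_const _ hDm]
    exact lintegral_congr fun z => (hDs z A hA).symm
  -- Normalization: the case `A = B`, divided by `c`.
  have hint : ∫⁻ z in B, D (s z) ∂μ = μ B := by
    have := hνo B hB
    rw [mul_comm] at this
    exact (ENNReal.mul_right_inj hcpos hcfin).1 this
  refine ⟨inferInstance, ν, fun x => D (s x) * (c / μ B), inferInstance, hmeas, fun x => ?_, ?_⟩
  · have h1 : c / μ B ≠ 0 := ENNReal.div_ne_zero.2 ⟨hcpos, hBfin⟩
    have h2 : c / μ B ≠ ∞ := ENNReal.div_ne_top hcfin hBpos.ne'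
    exact ⟨mul_ne_zero (by simpa using hD0 (s x)) h1, ENNReal.mul_ne_top ENNReal.coe_ne_top h2⟩
  · intro x A hA
    rw [hDs x A hA, mul_assoc]
    congr 1
    rw [← ENNReal.mul_div_right_comm, ENNReal.eq_div_iff hBpos.ne' hBfin, ← hint, hνo A hA]

/-! ### The topology of pointwise convergence on the group. -/

section
variable {G M : Type*} [Group G] [MetricSpace M] [MulAction G M] [IsIsometricSMul G M]

/-- The topology of pointwise convergence on a group of isometries, tested on the points `u n`. -/
abbrev pointwiseTopology (G : Type*) {M : Type*} [Group G] [MetricSpace M] [MulAction G M]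
    (u : ℕ → M) : TopologicalSpace G :=
  TopologicalSpace.induced (fun g n => g • u n) Pi.topologicalSpace

/-- Since the action is isometric, each orbit map is a uniform limit of the orbit maps of the `u n`,
hence continuous. Joint continuity follows because every `g` acts as a 1-Lipschitz map. -/
lemma continuous_smul_pointwiseTopology {u : ℕ → M} (hu : DenseRange u) :
    @Continuous (G × M) M (@instTopologicalSpaceProd G M (pointwiseTopology G u) _) _
      (fun p => p.1 • p.2) := by
  let _ := pointwiseTopology G u
  have hc : Continuous fun (g : G) n => g • u n := continuous_induced_dom
  have h0 : ∀ n, Continuous fun g : G => g • u n := continuous_pi_iff.1 hc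
  have h1 : ∀ x : M, Continuous fun g : G => g • x := by
    intro x
    refine continuous_of_uniform_approx_of_continuous fun V hV => ?_
    obtain ⟨ε, hε, hV⟩ := Metric.mem_uniformity_dist.1 hV
    obtain ⟨n, hn⟩ := hu.exists_dist_lt x hε
    exact ⟨_, h0 n, fun g => hV (by rwa [dist_smul])⟩
  have := continuous_prod_of_continuous_lipschitzWith (fun p : M × G => p.2 • p.1) 1 h1
    fun g => (isometry_smul M g).lipschitz
  exact this.comp continuous_swap

lemma continuous_smul_const_pointwiseTopology {u : ℕ → M} (hu : DenseRange u) (x : M) :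
    @Continuous G M (pointwiseTopology G u) _ (fun g => g • x) := by
  let _ := pointwiseTopology G u
  exact (continuous_smul_pointwiseTopology hu).comp (continuous_id.prodMk continuous_const)

/-- Inversion is continuous because `d(g⁻¹ x, h⁻¹ x) = d(h g⁻¹ x, x)` for isometries. -/
lemma isTopologicalGroup_pointwiseTopology {u : ℕ → M} (hu : DenseRange u) :
    @IsTopologicalGroup G (pointwiseTopology G u) _ := by
  let _ := pointwiseTopology G u
  have hs : Continuous fun p : G × M => p.1 • p.2 := continuous_smul_pointwiseTopology hu
  have hx : ∀ x : M, Continuous fun g : G => g • x := continuous_smul_const_pointwiseTopology hu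
  refine @IsTopologicalGroup.mk G _ _ ⟨?_⟩ ⟨?_⟩
  · refine continuous_induced_rng.2 (continuous_pi fun n => ?_)
    have : Continuous fun p : G × G => p.1 • (p.2 • u n) :=
      hs.comp (continuous_fst.prodMk ((hx (u n)).comp continuous_snd))
    simpa only [Function.comp_def, mul_smul] using this
  · refine continuous_induced_rng.2 (continuous_pi fun n => continuous_iff_continuousAt.2 fun g => ?_)
    refine tendsto_iff_dist_tendsto_zero.2 ?_
    have h1 : Tendsto (fun h : G => dist (g • g⁻¹ • u n) (h • g⁻¹ • u n)) (𝓝 g)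
        (𝓝 (dist (g • g⁻¹ • u n) (g • g⁻¹ • u n))) :=
      tendsto_const_nhds.dist ((hx (g⁻¹ • u n)).tendsto g)
    rw [dist_self] at h1
    refine h1.congr fun h => ?_
    rw [smul_inv_smul, ← dist_smul h⁻¹, inv_smul_smul]
    rfl

end

/-- The topology of pointwise convergence is coarser than the given one. -/
lemma IsCompact.pointwiseTopology {G M : Type*} [Group G] [τ : TopologicalSpace G] [MetricSpace M]
    [MulAction G M] [ContinuousSMul G M] (u : ℕ → M) {K : Set G} (hK : IsCompact K) :
    @IsCompact G (pointwiseTopology G u) K := by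
  have h : @Continuous G G τ (_root_.pointwiseTopology G u) id :=
    continuous_induced_rng.2 (continuous_pi fun n => continuous_id.smul continuous_const)
  simpa using @IsCompact.image G G τ (_root_.pointwiseTopology G u) _ id hK h

/-- If `G` is locally compact and `σ`-compact, then the elements of `G` that move a point by a
bounded distance form a compact set. -/
lemma isCompact_setOf_dist_smul_le {G M : Type*} [Group G] [TopologicalSpace G]
    [IsTopologicalGroup G] [LocallyCompactSpace G] [SigmaCompactSpace G]
    [MetricSpace M] [ProperSpace M] [MulAction G M] [MulAction.IsPretransitive G M]
    [ContinuousSMul G M] (o : M) (ho : IsCompact (MulAction.stabilizer G o : Set G)) (r : ℝ) :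
    IsCompact {g : G | dist (g • o) o ≤ r} := by
  have hcont : Continuous fun g : G => g • o := by fun_prop
  have hopen : IsOpenMap fun g : G => g • o := isOpenMap_smul_of_sigmaCompact o
  obtain ⟨C, hC, hBC⟩ : ∃ C : Set G, IsCompact C ∧
      Metric.closedBall o r ⊆ (fun g : G => g • o) '' C := by
    refine (isCompact_closedBall o r).induction_on (p := fun s => ∃ C : Set G, IsCompact C ∧
      s ⊆ (fun g : G => g • o) '' C) ⟨∅, isCompact_empty, empty_subset _⟩
      (fun s t hst ⟨C, hC, h⟩ => ⟨C, hC, hst.trans h⟩) ?_ ?_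
    · rintro s t ⟨C, hC, hs⟩ ⟨C', hC', ht⟩
      refine ⟨C ∪ C', hC.union hC', ?_⟩
      rw [image_union]
      exact union_subset_union hs ht
    · intro x _
      obtain ⟨g, rfl⟩ := MulAction.exists_smul_eq G o x
      obtain ⟨C, hC, hg⟩ := exists_compact_mem_nhds g
      exact ⟨_, mem_nhdsWithin_of_mem_nhds (hopen.image_mem_nhds hg), C, hC, Subset.rfl⟩
  -- If `g • o = h • o` with `h ∈ C`, then `g` lies in `C` times the stabilizer, a compact set.
  refine (hC.mul ho).of_isClosed_subset
    (isClosed_le (hcont.dist continuous_const) continuous_const) fun g hg => ?_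
  obtain ⟨h, hh, hhg⟩ := hBC (Metric.mem_closedBall.2 hg)
  refine ⟨h, hh, h⁻¹ * g, ?_, by simp⟩
  rw [SetLike.mem_coe, MulAction.mem_stabilizer_iff, mul_smul]
  simp only at hhg
  rw [← hhg, inv_smul_smul]

/-- The images of a suitable measure on the group under the orbit maps are the multiples of the
invariant measure. The group need not be second countable: the topology of pointwise convergence is
used instead of its own. -/
lemma exists_orbit_measure {G M : Type*} [Group G] [TopologicalSpace G]
    [IsTopologicalGroup G] [LocallyCompactSpace G] [SigmaCompactSpace G]
    [MetricSpace M] [ProperSpace M] [MeasurableSpace M] [BorelSpace M] [MulAction G M]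
    [IsIsometricSMul G M] [MulAction.IsPretransitive G M] [ContinuousSMul G M] (μ : Measure M)
    [SMulInvariantMeasure G M μ] [IsFiniteMeasureOnCompacts μ] (hμ : μ ≠ 0) (o : M)
    (ho : IsCompact (MulAction.stabilizer G o : Set G)) :
    ∃ (_ : MeasurableSpace G) (ν : Measure G) (δ : M → ℝ≥0∞), SFinite ν ∧
      Measurable (fun p : G × M => p.1 • p.2) ∧ (∀ x, δ x ≠ 0 ∧ δ x ≠ ∞) ∧
      ∀ x A, MeasurableSet A → ν {g | g • x ∈ A} = δ x * μ A := by
  have : SecondCountableTopology M := secondCountable_of_proper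
  have : Nonempty M := ⟨o⟩
  have hK := isCompact_setOf_dist_smul_le (G := G) o ho 1
  let u := TopologicalSpace.denseSeq M
  have hu : DenseRange u := TopologicalSpace.denseRange_denseSeq M
  have hK' := hK.pointwiseTopology u
  let τ : TopologicalSpace G := pointwiseTopology G u
  have hgroup : @IsTopologicalGroup G τ _ := isTopologicalGroup_pointwiseTopology hu
  have hsmul : @ContinuousSMul G M _ τ _ :=
    @ContinuousSMul.mk G M _ τ _ (continuous_smul_pointwiseTopology hu)
  have hsc : @SecondCountableTopology G τ :=
    TopologicalSpace.secondCountableTopology_induced G (ℕ → M) _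
  have hlc : @LocallyCompactSpace G τ := by
    -- The compact set of `hK'` is a neighbourhood of `1`, being the preimage of a ball under a
    -- continuous orbit map.
    refine @IsCompact.locallyCompactSpace_of_mem_nhds_of_group G τ _ hgroup _ hK' 1 ?_
    have h1 := continuous_smul_const_pointwiseTopology (G := G) hu o
    have h2 := (@Continuous.continuousAt G M τ _ _ 1 h1).preimage_mem_nhds
      (Metric.closedBall_mem_nhds ((1 : G) • o) one_pos)
    simpa [preimage] using h2
  exact @exists_orbit_measure_of_secondCountable G M _ τ hgroup hsc hlc _ _ _ _ _ _ _ hsmul μ _ _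
    hμ o hK'

/-! ### The isoperimetric inequality by averaging. -/

/-- A lower bound for the relative growth of all small thickenings bounds the perimeter. -/
lemma le_mul_minkowskiContent {M : Type*} [MetricSpace M] [MeasurableSpace M] {μ : Measure M}
    {A : Set M} {t c : ℝ≥0∞} (hc0 : c ≠ 0) (hc : c ≠ ∞) {h₀ : ℝ} (hh₀ : 0 < h₀)
    (h : ∀ h, 0 < h → h < h₀ → t * ENNReal.ofReal h ≤ c * (μ (Metric.thickening h A) - μ A)) :
    t ≤ c * minkowskiContent μ A := by
  rw [← ENNReal.div_le_iff' hc0 hc]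
  refine le_liminf_of_le (by isBoundedDefault) ?_
  filter_upwards [Ioo_mem_nhdsGT hh₀] with s hs
  have hs0 : ENNReal.ofReal s ≠ 0 := by simpa using hs.1
  rw [ENNReal.div_le_iff' hc0 hc, ← mul_div_assoc, ENNReal.le_div_iff_mul_le (Or.inl hs0)
    (Or.inl ENNReal.ofReal_ne_top)]
  exact h s hs.1 hs.2

/-- Averaging over a ball whose measure is at least `2 μ(A)`. -/
lemma orbit_measure_le_of_exit_le {G M : Type*} [Group G] [MulAction G M] [MeasurableSpace M]
    [MeasurableSpace G] {μ : Measure M} {ν : Measure G} [SFinite ν] [SFinite μ]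
    [SMulInvariantMeasure G M μ] {δ : M → ℝ≥0∞}
    (hν : ∀ x A, MeasurableSet A → ν {g | g • x ∈ A} = δ x * μ A)
    (hmeas : Measurable fun p : G × M => p.1 • p.2) {A B : Set M} (hA : MeasurableSet A)
    (hB : MeasurableSet B) (hBfin : μ B ≠ ∞) (hAB : 2 * μ A ≤ μ B) {o : M} {Q : ℝ≥0∞}
    (hQ : ∀ z ∈ B, ν {g | g • o ∈ A ∧ g • z ∉ A} ≤ Q) : δ o * μ A ≤ 2 * Q := by
  by_cases hB0 : μ B = 0
  · have : μ A = 0 := by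
      rw [hB0, nonpos_iff_eq_zero, mul_eq_zero] at hAB
      exact hAB.resolve_left two_ne_zero
    simp [this]
  have hgo : Measurable fun g : G => g • o := hmeas.comp (measurable_id.prodMk measurable_const)
  -- The measure of `S` is computed in both orders: for fixed `z` the slice is at most `Q`; for
  -- fixed `g` with `g • o ∈ A`, at least half of `B` lies outside `g⁻¹ A`.
  let S : Set (G × M) := {p | p.1 • o ∈ A ∧ p.2 ∈ B ∧ p.1 • p.2 ∉ A}
  have hS : MeasurableSet S :=
    (hgo.comp measurable_fst hA).inter ((measurable_snd hB).inter (hmeas hA).compl)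
  have h1 : ν.prod μ S ≤ Q * μ B := by
    rw [Measure.prod_apply_symm hS]
    calc _ ≤ ∫⁻ z, B.indicator (fun _ => Q) z ∂μ := by
          refine lintegral_mono fun z => ?_
          by_cases hz : z ∈ B
          · rw [indicator_of_mem hz]
            have hsub : (fun g => (g, z)) ⁻¹' S ⊆ {g | g • o ∈ A ∧ g • z ∉ A} :=
              fun g hg => ⟨hg.1, hg.2.2⟩
            exact (measure_mono hsub).trans (hQ z hz)
          · rw [indicator_of_notMem hz, nonpos_iff_eq_zero]
            convert measure_empty (μ := ν)
            ext g
            exact ⟨fun hg => hz hg.2.1, fun hg => hg.elim⟩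
      _ = _ := by rw [lintegral_indicator_const hB]
  have h2 : μ B / 2 * (δ o * μ A) ≤ ν.prod μ S := by
    rw [Measure.prod_apply hS]
    calc _ = ∫⁻ g, {g : G | g • o ∈ A}.indicator (fun _ => μ B / 2) g ∂ν := by
          rw [lintegral_indicator_const (show MeasurableSet {g : G | g • o ∈ A} from hgo hA),
            hν o A hA]
      _ ≤ _ := by
          refine lintegral_mono fun g => ?_
          by_cases hg : g • o ∈ A
          · rw [indicator_of_mem (show g ∈ {g : G | g • o ∈ A} from hg)]
            have e1 : B \ (g • ·) ⁻¹' A ⊆ Prod.mk g ⁻¹' S := fun z hz => ⟨hg, hz.1, hz.2⟩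
            have e2 : μ B - μ A ≤ μ (B \ (g • ·) ⁻¹' A) := by
              rw [← SMulInvariantMeasure.measure_preimage_smul (μ := μ) g hA]
              exact le_measure_sdiff
            refine le_trans ?_ (e2.trans (measure_mono e1))
            have e3 : μ A ≤ μ B / 2 := by
              rw [ENNReal.le_div_iff_mul_le (by simp) (by simp), mul_comm]
              exact hAB
            calc μ B / 2 = μ B - μ B / 2 := (ENNReal.sub_half hBfin).symm
              _ ≤ _ := tsub_le_tsub_left e3 _
          · rw [indicator_of_notMem (show g ∉ {g : G | g • o ∈ A} from hg)]
            exact zero_le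
  have h3 : μ B * (δ o * μ A) ≤ μ B * (2 * Q) := by
    calc μ B * (δ o * μ A) = 2 * (μ B / 2 * (δ o * μ A)) := by
          rw [← mul_assoc 2, ENNReal.mul_div_cancel two_ne_zero ENNReal.ofNat_ne_top]
      _ ≤ 2 * (Q * μ B) := by exact mul_le_mul_right (h2.trans h1) 2
      _ = _ := by ring
  exact (ENNReal.mul_le_mul_iff_right hB0 hBfin).1 h3

section
variable {G M : Type*} [Group G] [MetricSpace M] [MulAction G M] [IsIsometricSMul G M]

lemma smul_mem_thickening {A : Set M} {x y : M} {h : ℝ} (hxy : dist x y < h) {g : G}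
    (hg : g • x ∈ A) : g • y ∈ Metric.thickening h A :=
  Metric.mem_thickening_iff.2 ⟨_, hg, by rwa [dist_smul, dist_comm]⟩

variable [MeasurableSpace M] [BorelSpace M] [MeasurableSpace G] {μ : Measure M} {ν : Measure G}
  {δ : M → ℝ≥0∞} (hν : ∀ x A, MeasurableSet A → ν {g | g • x ∈ A} = δ x * μ A)
include hν

lemma orbit_measure_le_thickening {A : Set M} (hA : MeasurableSet A) {x y : M} {h : ℝ}
    (hxy : dist x y < h) : δ x * μ A ≤ δ y * μ (Metric.thickening h A) := by
  rw [← hν x A hA, ← hν y _ Metric.isOpen_thickening.measurableSet]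
  exact measure_mono fun g hg => smul_mem_thickening hxy hg

/-- If `g` sends the start of the chain into `A` and its end outside, the first point sent outside
lands in `A_h \ A`. The bound is a union over the `n` steps. -/
lemma measure_exit_chain_le {A : Set M} (hA : MeasurableSet A) {h : ℝ} {n : ℕ} {f : ℕ → M}
    (hf : ∀ i < n, dist (f i) (f (i + 1)) < h) {D : ℝ≥0∞} (hD : ∀ i, δ (f i) ≤ D) :
    ν {g | g • f 0 ∈ A ∧ g • f n ∉ A} ≤ n * (D * μ (Metric.thickening h A \ A)) := by
  have hsub : {g : G | g • f 0 ∈ A ∧ g • f n ∉ A} ⊆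
      ⋃ i ∈ Finset.range n, {g : G | g • f (i + 1) ∈ Metric.thickening h A \ A} := by
    rintro g ⟨h0, hn⟩
    by_contra hcon
    simp only [mem_iUnion, Finset.mem_range, not_exists] at hcon
    refine hn ?_
    have : ∀ i ≤ n, g • f i ∈ A := by
      intro i
      induction i with
      | zero => exact fun _ => h0
      | succ i ih =>
        intro hi
        by_contra hno
        exact hcon i (by omega) ⟨smul_mem_thickening (hf i (by omega)) (ih (by omega)), hno⟩
    exact this n le_rfl
  calc _ ≤ _ := measure_mono hsub
    _ ≤ ∑ i ∈ Finset.range n, ν {g : G | g • f (i + 1) ∈ Metric.thickening h A \ A} :=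
      measure_biUnion_finset_le _ _
    _ ≤ ∑ i ∈ Finset.range n, D * μ (Metric.thickening h A \ A) := by
      refine Finset.sum_le_sum fun i _ => ?_
      rw [hν _ _ (Metric.isOpen_thickening.measurableSet.diff hA)]
      gcongr
      exact hD _
    _ = _ := by simp

/-- The isoperimetric inequality for sets that fill at most half of a ball on which the density `δ`
is comparable to its value at the centre. -/
lemma measure_le_mul_minkowskiContent_of_le [SFinite ν] [SFinite μ] [SMulInvariantMeasure G M μ]
    (hmeas : Measurable fun p : G × M => p.1 • p.2) (hδ : ∀ x, δ x ≠ 0 ∧ δ x ≠ ∞)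
    {L : ℝ} (hL0 : 0 < L) (hL : ∀ x y : M, ∃ γ : Path x y,
      eVariationOn (γ : unitInterval → M) univ ≤ ENNReal.ofReal (L * dist x y))
    {o : M} {r : ℝ} (hr : 0 < r) {E : ℝ≥0∞} (hE0 : E ≠ 0) (hEtop : E ≠ ∞)
    (hE : ∀ x, dist x o ≤ L * r → δ x ≤ E * δ o) {A : Set M} (hA : MeasurableSet A)
    (hBfin : μ (Metric.closedBall o r) ≠ ∞) (hAB : 2 * μ A ≤ μ (Metric.closedBall o r)) :
    μ A ≤ E * ENNReal.ofReal (8 * L) * ENNReal.ofReal r * minkowskiContent μ A := by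
  have hLr : 0 < L * r := by positivity
  have hAfin : μ A ≠ ∞ := by
    intro h
    rw [h, ENNReal.mul_top two_ne_zero] at hAB
    exact hBfin (top_le_iff.1 hAB)
  refine le_mul_minkowskiContent (by simp [hE0, hL0, hr]) (ENNReal.mul_ne_top (ENNReal.mul_ne_top
    hEtop ENNReal.ofReal_ne_top) ENNReal.ofReal_ne_top) hLr fun h hh hhL => ?_
  rw [← measure_sdiff (Metric.self_subset_thickening hh A) hA.nullMeasurableSet hAfin]
  set d := μ (Metric.thickening h A \ A)
  -- In `Q`, the factor `4 L r / h` bounds the number of steps and `E * δ o` bounds `δ` on the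
  -- chain, which stays within `L r` of `o`.
  have key := orbit_measure_le_of_exit_le hν hmeas hA Metric.isClosed_closedBall.measurableSet
    hBfin hAB (o := o) (Q := ENNReal.ofReal (4 * (L * r) / h) * (E * δ o * d)) fun z hz => by
      obtain ⟨γ, hγ⟩ := hL o z
      obtain ⟨n, hn, f, f0, fn, fd, fl⟩ := exists_chain γ hh hhL.le (hγ.trans
        (ENNReal.ofReal_le_ofReal (mul_le_mul_of_nonneg_left
          (by rw [dist_comm]; exact hz) hL0.le)))
      have := measure_exit_chain_le hν hA fd (fun i => hE _ (fl i))
      rw [f0, fn] at this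
      refine this.trans ?_
      gcongr
      rw [← ENNReal.ofReal_natCast]
      exact ENNReal.ofReal_le_ofReal ((le_div_iff₀ hh).2 hn)
  refine (ENNReal.mul_le_mul_iff_right (hδ o).1 (hδ o).2).1 ?_
  calc δ o * (μ A * ENNReal.ofReal h) = (δ o * μ A) * ENNReal.ofReal h := by ring
    _ ≤ 2 * (ENNReal.ofReal (4 * (L * r) / h) * (E * δ o * d)) * ENNReal.ofReal h := by gcongr
    _ = (2 * ENNReal.ofReal (4 * (L * r) / h) * ENNReal.ofReal h) * (E * δ o * d) := by ring
    _ = (ENNReal.ofReal (8 * L) * ENNReal.ofReal r) * (E * δ o * d) := by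
      congr 1
      rw [← ENNReal.ofReal_ofNat 2, ← ENNReal.ofReal_mul (by norm_num),
        ← ENNReal.ofReal_mul (by positivity), ← ENNReal.ofReal_mul (by positivity)]
      congr 1
      field_simp
      ring
    _ = _ := by ring

/-! ### Variation of the density. -/

/-- A nonconstant density `δ` forces a linear isoperimetric inequality. -/
lemma exists_linear_isoperimetric_of_ne (hδ : ∀ x, δ x ≠ 0 ∧ δ x ≠ ∞)
    {a b : M} {ℓ : ℝ} (hℓ : 0 < ℓ) (γ : Path a b)
    (hγ : eVariationOn (γ : unitInterval → M) univ ≤ ENNReal.ofReal ℓ) (hab : δ b < δ a) :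
    ∃ c : ℝ≥0∞, c ≠ 0 ∧ c ≠ ∞ ∧ ∀ A, MeasurableSet A → μ A ≠ ∞ →
      μ A ≤ c * minkowskiContent μ A := by
  have hb0 : 0 < (δ b).toReal := ENNReal.toReal_pos (hδ b).1 (hδ b).2
  have hab' : (δ b).toReal < (δ a).toReal := (ENNReal.toReal_lt_toReal (hδ b).2 (hδ a).2).2 hab
  set ρ := (δ a).toReal / (δ b).toReal
  have hρ : 1 < ρ := (one_lt_div hb0).2 hab'
  have hlog : 0 < Real.log ρ := Real.log_pos hρ
  have hc : 0 < 4 * ℓ / Real.log ρ := by positivity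
  refine ⟨ENNReal.ofReal (4 * ℓ / Real.log ρ), by simpa using hc, ENNReal.ofReal_ne_top,
    fun A hA hAfin => ?_⟩
  refine le_mul_minkowskiContent (by simpa using hc) ENNReal.ofReal_ne_top hℓ fun h hh hhℓ => ?_
  by_cases hA0 : μ A = 0
  · simp [hA0]
  by_cases htop : μ (Metric.thickening h A) = ∞
  · rw [htop, ENNReal.top_sub hAfin, ENNReal.mul_top (by simpa using hc)]
    exact le_top
  obtain ⟨n, hn, f, f0, fn, fd, -⟩ := exists_chain γ hh hhℓ.le hγ
  set m := (μ A).toReal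
  set m' := (μ (Metric.thickening h A)).toReal
  have hm : 0 < m := ENNReal.toReal_pos hA0 hAfin
  have hle : μ A ≤ μ (Metric.thickening h A) := measure_mono (Metric.self_subset_thickening hh A)
  have hmm' : m ≤ m' := ENNReal.toReal_mono htop hle
  have hstep : ∀ i < n, (δ (f i)).toReal ≤ m' / m * (δ (f (i + 1))).toReal := by
    intro i hi
    have := ENNReal.toReal_mono (ENNReal.mul_ne_top (hδ (f (i + 1))).2 htop)
      (orbit_measure_le_thickening hν hA (fd i hi))
    rw [ENNReal.toReal_mul, ENNReal.toReal_mul] at this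
    rw [div_mul_eq_mul_div, le_div_iff₀ hm]
    linarith
  have hq : 0 < m' / m := div_pos (hm.trans_le hmm') hm
  have hpow : ∀ i ≤ n, (δ a).toReal ≤ (m' / m) ^ i * (δ (f i)).toReal := by
    intro i
    induction i with
    | zero => simp [f0]
    | succ i ih =>
      intro hi
      refine (ih (by omega)).trans ?_
      rw [pow_succ, mul_assoc]
      exact mul_le_mul_of_nonneg_left (hstep i (by omega)) (by positivity)
  have hρq : ρ ≤ (m' / m) ^ n := by
    rw [div_le_iff₀ hb0, ← fn]
    exact hpow n le_rfl
  -- `log q ≤ q - 1` turns the multiplicative growth over `n` steps into a bound linear in `m' - m`.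
  have hl : Real.log ρ ≤ n * (m' / m - 1) := by
    calc Real.log ρ ≤ Real.log ((m' / m) ^ n) := Real.log_le_log (by linarith) hρq
      _ = n * Real.log (m' / m) := Real.log_pow _ _
      _ ≤ _ := mul_le_mul_of_nonneg_left (Real.log_le_sub_one_of_pos hq) (Nat.cast_nonneg n)
  have hfin : m * h ≤ 4 * ℓ / Real.log ρ * (m' - m) := by
    rw [div_mul_eq_mul_div, le_div_iff₀ hlog]
    have e : m * (n * (m' / m - 1)) = n * (m' - m) := by field_simp
    calc m * h * Real.log ρ = h * (m * Real.log ρ) := by ring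
      _ ≤ h * (m * (n * (m' / m - 1))) := by gcongr
      _ = n * h * (m' - m) := by rw [e]; ring
      _ ≤ 4 * ℓ * (m' - m) := mul_le_mul_of_nonneg_right hn (by linarith)
  rw [← ENNReal.ofReal_toReal hAfin, ← ENNReal.ofReal_toReal htop,
    ← ENNReal.ofReal_sub _ hm.le, ← ENNReal.ofReal_mul hm.le, ← ENNReal.ofReal_mul hc.le]
  exact ENNReal.ofReal_le_ofReal hfin

/-- The density `δ` is bounded on bounded sets. -/
lemma exists_orbit_density_le [ProperSpace M] [IsFiniteMeasureOnCompacts μ]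
    (o : M) (hpos : 0 < μ (Metric.closedBall o 1)) (R : ℝ) :
    ∃ E : ℝ≥0∞, E ≠ ∞ ∧ ∀ x, dist x o ≤ R → δ x ≤ E * δ o := by
  -- If `d(x, o) ≤ R` and `g • x ∈ B(o, 1)`, then `g • o ∈ B(o, 1 + R)`; taking `ν` of both sets
  -- gives this ratio.
  refine ⟨μ (Metric.closedBall o (1 + R)) / μ (Metric.closedBall o 1), ENNReal.div_ne_top
    (isCompact_closedBall o _).measure_lt_top.ne hpos.ne', fun x hx => ?_⟩
  have hfin : μ (Metric.closedBall o 1) ≠ ∞ := (isCompact_closedBall o _).measure_lt_top.ne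
  rw [← ENNReal.mul_div_right_comm, ENNReal.le_div_iff_mul_le (Or.inl hpos.ne') (Or.inl hfin),
    mul_comm _ (δ o), ← hν x _ Metric.isClosed_closedBall.measurableSet,
    ← hν o _ Metric.isClosed_closedBall.measurableSet]
  refine measure_mono fun g hg => ?_
  have h1 : dist (g • x) o ≤ 1 := hg
  have h2 : dist (g • o) (g • x) ≤ R := by rwa [dist_smul, dist_comm]
  exact Metric.mem_closedBall.2 ((dist_triangle _ (g • x) _).trans (by linarith))

end

/-! ### The profile. -/

lemma mul_le_mul_isoProfile_of_forall {M : Type*} [MetricSpace M] [MeasurableSpace M]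
    {μ : Measure M} {t c : ℝ≥0∞} (hc0 : c ≠ 0) (hc : c ≠ ∞)
    (h : ∀ A, MeasurableSet A → μ A = t → t ≤ c * minkowskiContent μ A) :
    t ≤ c * isoProfile μ t := by
  rw [← ENNReal.div_le_iff' hc0 hc]
  refine le_iInf fun A => le_iInf fun hA => le_iInf fun ht => ?_
  rw [ENNReal.div_le_iff' hc0 hc]
  exact h A hA ht

/-- The profile does not decrease from `m / 2` to `m` if `m` is at most half of the total measure. -/
lemma HasConcaveProfile.isoProfile_half_le {M : Type*} [MetricSpace M] [MeasurableSpace M]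
    {μ : Measure M} (hI : HasConcaveProfile μ) {m : ℝ≥0∞} (hm0 : m ≠ 0) (hm : m ≠ ∞)
    (hle : m ≤ μ univ / 2) : isoProfile μ (m / 2) ≤ isoProfile μ m := by
  by_cases hμ : μ univ = ∞
  · exact hI.increasing hμ (ENNReal.div_lt_top hm two_ne_zero) hm.lt_top ENNReal.half_le_self
  obtain ⟨T, hT⟩ : ∃ T : ℝ, T = (μ univ).toReal := ⟨_, rfl⟩
  obtain ⟨t, ht⟩ : ∃ t : ℝ, t = m.toReal := ⟨_, rfl⟩
  have ht0 : 0 < t := ht ▸ ENNReal.toReal_pos hm0 hm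
  have hmt : m = ENNReal.ofReal t := by rw [ht, ENNReal.ofReal_toReal hm]
  have hμT : μ univ = ENNReal.ofReal T := by rw [hT, ENNReal.ofReal_toReal hμ]
  have htT : t ≤ T / 2 := by
    have := ENNReal.toReal_mono (ENNReal.div_ne_top hμ two_ne_zero) hle
    rwa [ENNReal.toReal_div, ← ht, ← hT] at this
  have hdom : ∀ s : ℝ, 0 ≤ s → s < T → s ∈ profileDomain μ := fun s h0 hs =>
    ⟨h0, by rw [hμT]; exact (ENNReal.ofReal_lt_ofReal_iff (h0.trans_lt hs)).2 hs⟩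
  have hhalf : m / 2 = ENNReal.ofReal (t / 2) := by
    rw [hmt, ENNReal.ofReal_div_of_pos two_pos, ENNReal.ofReal_ofNat]
  have h1 : t / 2 ∈ profileDomain μ := hdom _ (by linarith) (by linarith)
  have h2 : T - t / 2 ∈ profileDomain μ := hdom _ (by linarith) (by linarith)
  have h3 : t ∈ profileDomain μ := hdom _ (by linarith) (by linarith)
  have hsym : isoProfile μ (ENNReal.ofReal (T - t / 2)) = isoProfile μ (ENNReal.ofReal (t / 2)) := by
    rw [ENNReal.ofReal_sub _ (by linarith), ← hμT]
    exact hI.symmetric hμ _ h1 (by linarith)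
  -- By symmetry the profile agrees at `t / 2` and `T - t / 2`, and concavity keeps it at least as
  -- large in between.
  have hseg : t ∈ segment ℝ (t / 2) (T - t / 2) := by
    rw [segment_eq_Icc (by linarith)]
    constructor <;> linarith
  have hmin := hI.concave.min_le_of_mem_segment h1 h2 hseg
  simp only [hsym, min_self] at hmin
  rw [hhalf, hmt]
  exact (ENNReal.toReal_le_toReal (hI.finite _ h1) (hI.finite _ h3)).1 hmin

/-! ### Homogeneous spaces and the theorem. -/

lemma IsHomogeneousMMS.isIsometricSMul {G M : Type*} [Group G] [TopologicalSpace G] [MetricSpace M]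
    [MeasurableSpace M] [MulAction G M] {μ : Measure M}
    (hM : IsHomogeneousMMS G μ) : IsIsometricSMul G M :=
  ⟨fun g => Isometry.of_dist_eq (hM.invariant_dist g)⟩

/-- Points are null sets in a homogeneous metric measure space with a finite profile. -/
lemma IsHomogeneousMMS.measure_singleton {G M : Type*} [Group G] [TopologicalSpace G] [MetricSpace M]
    [MeasurableSpace M] [BorelSpace M] [MulAction G M] {μ : Measure M}
    (hM : IsHomogeneousMMS G μ) (o : M) : μ {o} = 0 := by
  by_contra h0
  have hfin : μ {o} ≠ ∞ := (hM.finite_on_compacts _ isCompact_singleton).ne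
  have heq : ∀ x : M, μ {x} = μ {o} := by
    intro x
    have := hM.transitive
    obtain ⟨g, rfl⟩ := MulAction.exists_smul_eq G o x
    rw [← hM.invariant_measure g {g • o} (measurableSet_singleton _)]
    congr 1
    ext y
    simp
  have ht : ENNReal.ofReal (μ {o} / 2).toReal = μ {o} / 2 :=
    ENNReal.ofReal_toReal (ENNReal.div_ne_top hfin two_ne_zero)
  have hlt : μ {o} / 2 < μ {o} := ENNReal.half_lt_self h0 hfin
  have hI := hM.profile.finite (μ {o} / 2).toReal
    ⟨ENNReal.toReal_nonneg, by rw [ht]; exact hlt.trans_le (measure_mono (subset_univ _))⟩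
  rw [ht] at hI
  -- All points have the same mass, so no set has measure `μ {o} / 2` and the infimum is over
  -- nothing.
  refine hI (iInf_eq_top.2 fun A => iInf_eq_top.2 fun _ => iInf_eq_top.2 fun hA => ?_)
  exfalso
  rcases A.eq_empty_or_nonempty with rfl | ⟨x, hx⟩
  · rw [measure_empty] at hA
    exact h0 (by simpa using hA.symm)
  · have := measure_mono (μ := μ) (singleton_subset_iff.2 hx)
    rw [heq, hA] at this
    exact hlt.not_ge this

lemma IsHomogeneousMMS.properSpace {G M : Type*} [Group G] [TopologicalSpace G] [MetricSpace M]
    [MeasurableSpace M] [MulAction G M] {μ : Measure M} (hM : IsHomogeneousMMS G μ) (o : M) :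
    ProperSpace M := by
  have := hM.isIsometricSMul
  have := hM.locallyCompact
  have := hM.transitive
  obtain ⟨K, hK, hKo⟩ := exists_compact_mem_nhds o
  obtain ⟨ε, hε, hεK⟩ := Metric.nhds_basis_closedBall.mem_iff.1 hKo
  refine hM.length_compatible.properSpace hε (fun x => ?_) o
  obtain ⟨g, rfl⟩ := MulAction.exists_smul_eq G o x
  rw [← Metric.smul_closedBall]
  exact (hK.of_isClosed_subset Metric.isClosed_closedBall hεK).image (isometry_smul M g).continuous

/-- The isoperimetric inequality in a homogeneous metric measure space, for sets that fill at most
half of a ball. -/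
lemma IsHomogeneousMMS.exists_measure_le_mul_minkowskiContent {G M : Type*} [Group G]
    [TopologicalSpace G] [IsTopologicalGroup G] [LocallyCompactSpace G] [SigmaCompactSpace G]
    [MetricSpace M] [MeasurableSpace M] [BorelSpace M] [MulAction G M] {μ : Measure M}
    (hM : IsHomogeneousMMS G μ) (o : M) :
    ∃ c : ℝ≥0∞, c ≠ 0 ∧ c ≠ ∞ ∧ ∀ r : ℝ, 0 < r → ∀ A, MeasurableSet A →
      2 * μ A ≤ μ (Metric.closedBall o r) →
      μ A ≤ c * ENNReal.ofReal r * minkowskiContent μ A := by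
  have := hM.isIsometricSMul
  have := hM.properSpace o
  have := hM.transitive
  have := hM.continuous_action
  have : SMulInvariantMeasure G M μ := ⟨fun g A hA => hM.invariant_measure g A hA⟩
  have : IsFiniteMeasureOnCompacts μ := ⟨fun K hK => hM.finite_on_compacts K hK⟩
  have : SecondCountableTopology M := secondCountable_of_proper
  by_cases hμ : μ = 0
  · exact ⟨1, one_ne_zero, ENNReal.one_ne_top, fun r _ A _ _ => by simp [hμ]⟩
  obtain ⟨_, ν, δ, _, hmeas, hδ, hν⟩ :=
    exists_orbit_measure (G := G) μ hμ o (hM.isotropy_compact o)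
  obtain ⟨L, hL0, hL⟩ : ∃ L : ℝ, 0 < L ∧ ∀ x y : M, ∃ γ : Path x y,
      eVariationOn (γ : unitInterval → M) univ ≤ ENNReal.ofReal (L * dist x y) := by
    obtain ⟨L, hL⟩ := hM.length_compatible
    refine ⟨L + 1, by positivity, fun x y => ?_⟩
    obtain ⟨γ, hγ⟩ := hL x y
    refine ⟨γ, hγ.trans ?_⟩
    rw [edist_dist, ENNReal.ofReal_mul (by positivity), ← ENNReal.ofReal_coe_nnreal]
    gcongr
    linarith
  have hL8 : ENNReal.ofReal (8 * L) ≠ 0 := by simpa using hL0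
  have hfin : ∀ r, μ (Metric.closedBall o r) ≠ ∞ := fun r =>
    (isCompact_closedBall o r).measure_lt_top.ne
  by_cases hconst : ∀ x, δ x = δ o
  · refine ⟨ENNReal.ofReal (8 * L), hL8, ENNReal.ofReal_ne_top, fun r hr A hA hAB => ?_⟩
    simpa using measure_le_mul_minkowskiContent_of_le hν hmeas hδ hL0 hL hr one_ne_zero
      ENNReal.one_ne_top (fun x _ => by rw [hconst x, one_mul]) hA (hfin r) hAB
  obtain ⟨c, hc0, hc, hlin⟩ : ∃ c : ℝ≥0∞, c ≠ 0 ∧ c ≠ ∞ ∧ ∀ A, MeasurableSet A → μ A ≠ ∞ →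
      μ A ≤ c * minkowskiContent μ A := by
    push Not at hconst
    obtain ⟨x, hx⟩ := hconst
    have hxo : x ≠ o := fun h => hx (h ▸ rfl)
    rcases lt_or_gt_of_ne hx with h | h
    · obtain ⟨γ, hγ⟩ := hL o x
      exact exists_linear_isoperimetric_of_ne hν hδ (mul_pos hL0 (dist_pos.2 hxo.symm)) γ hγ h
    · obtain ⟨γ, hγ⟩ := hL x o
      exact exists_linear_isoperimetric_of_ne hν hδ (mul_pos hL0 (dist_pos.2 hxo)) γ hγ h
  obtain ⟨E, hE, hEδ⟩ := exists_orbit_density_le hν o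
    (measure_closedBall_pos_of_smulInvariant G μ hμ o one_pos) L
  -- The term `c` serves `r ≥ 1`, the other one `r ≤ 1`, where `L r ≤ L` puts the chains in the
  -- range of `hEδ`. `E + 1` is visibly nonzero.
  refine ⟨c + (E + 1) * ENNReal.ofReal (8 * L), by simp [hc0], by finiteness, fun r hr A hA hAB => ?_⟩
  rcases le_total 1 r with h1 | h1
  · have hA' : μ A ≠ ∞ := by
      intro h
      rw [h, ENNReal.mul_top two_ne_zero] at hAB
      exact hfin r (top_le_iff.1 hAB)
    calc μ A ≤ c * 1 * minkowskiContent μ A := by simpa using hlin A hA hA'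
      _ ≤ _ := by
        gcongr
        · exact le_self_add
        · exact ENNReal.one_le_ofReal.2 h1
  · have := measure_le_mul_minkowskiContent_of_le hν hmeas hδ hL0 hL hr (E := E + 1) (by simp)
      (by finiteness) (fun x hx => (hEδ x (hx.trans (by nlinarith))).trans (by gcongr; simp))
      hA (hfin r) hAB
    refine this.trans ?_
    gcongr
    exact le_add_self

theorem theorem4p2 {G M : Type*} [Group G] [TopologicalSpace G] [IsTopologicalGroup G]
    [LocallyCompactSpace G] [SigmaCompactSpace G]
    [MetricSpace M] [MeasurableSpace M] [BorelSpace M] [MulAction G M]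
    (μ : Measure M) (hM : IsHomogeneousMMS G μ) (o : M)
    (w : M → ℝ) (hw_meas : AEMeasurable w μ) (hw_nonneg : ∀ x, 0 ≤ w x)
    (hw : ∀ r : ℝ, 0 < r → μ {x | w x ≤ r} ≤ μ (Metric.closedBall o r)) :
    (∀ᵐ x ∂μ, 0 < w x) ∧ HasIsoperimetricGrowth μ w ∧
      (LocallyIntegrable w μ → IsIsoperimetricWeight μ w) := by
  have hproper := hM.properSpace o
  have hfin : ∀ r, μ (Metric.closedBall o r) ≠ ∞ := fun r =>
    (hM.finite_on_compacts _ (isCompact_closedBall o r)).ne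
  have hpos : ∀ᵐ x ∂μ, 0 < w x := by
    have hlim : Tendsto (fun r => μ (Metric.cthickening r {o})) (𝓝 0) (𝓝 (μ {o})) :=
      tendsto_measure_cthickening_of_isClosed ⟨1, one_pos, by
        rw [Metric.cthickening_singleton _ zero_le_one]; exact hfin 1⟩ isClosed_singleton
    rw [hM.measure_singleton o] at hlim
    have h0 : μ {x | ¬ 0 < w x} ≤ 0 := by
      refine ge_of_tendsto (x := 𝓝[>] 0) (hlim.mono_left nhdsWithin_le_nhds) ?_
      filter_upwards [self_mem_nhdsWithin] with r hr
      have hr' : 0 < r := hr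
      rw [Metric.cthickening_singleton _ hr'.le]
      exact (measure_mono fun x hx => (not_lt.1 hx).trans hr'.le).trans (hw r hr')
    exact nonpos_iff_eq_zero.1 h0
  have hgrowth : HasIsoperimetricGrowth μ w := by
    obtain ⟨c, hc0, hc, hiso⟩ := hM.exists_measure_le_mul_minkowskiContent o
    -- The factor `2` pays for passing from `m` to `m / 2`, since the inequality covers only half of
    -- the ball.
    refine ⟨(2 * c).toReal, ENNReal.toReal_pos (by simp [hc0]) (by finiteness), fun r hr => ?_⟩
    rw [ENNReal.ofReal_mul ENNReal.toReal_nonneg, ENNReal.ofReal_toReal (by finiteness)]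
    refine ENNReal.div_le_of_le_mul ?_
    set m := min (μ {x | w x ≤ r}) (μ univ / 2)
    by_cases hm0 : m = 0
    · simp [hm0]
    have hmr : m ≤ μ (Metric.closedBall o r) := (min_le_left _ _).trans (hw r hr)
    have hm : m ≠ ∞ := ne_top_of_le_ne_top (hfin r) hmr
    have hcr : c * ENNReal.ofReal r ≠ 0 := by simp [hc0, hr]
    have hhalf : m / 2 ≤ c * ENNReal.ofReal r * isoProfile μ (m / 2) :=
      mul_le_mul_isoProfile_of_forall hcr (by finiteness) fun A hA hAm => by
        rw [← hAm]
        refine hiso r hr A hA ?_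
        rwa [hAm, ENNReal.mul_div_cancel two_ne_zero ENNReal.ofNat_ne_top]
    calc m = 2 * (m / 2) := (ENNReal.mul_div_cancel two_ne_zero ENNReal.ofNat_ne_top).symm
      _ ≤ 2 * (c * ENNReal.ofReal r * isoProfile μ m) := by
        gcongr
        refine hhalf.trans ?_
        gcongr
        exact hM.profile.isoProfile_half_le hm0 hm (min_le_right _ _)
      _ = _ := by ring
  exact ⟨hpos, hgrowth, fun hloc => ⟨hw_nonneg, hloc, hpos, hgrowth⟩⟩
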